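/- Let $s_0\in\mathbb{R}$ and let $\mathcal{S}$ be a nonempty set of real sequences $S=(S_j)_{j\in\mathbb{N}_0}$ with $S_0=s_0$ (a trajectory set). **Nodes.** For $S\in\mathcal{S}$ and $j\in\mathbb{N}_0$ let $\mathcal{S}_{(S,j)}=\{\tilde S\in\mathcal{S}:\tilde S_i=S_i \text{ for } 0\le i\le j\}$ (the node of $S$ at time $j$) and $\mathcal{S}^{(S,j)}=\{(\tilde S_{j+i})_{i\ge 0}:\tilde S\in\mathcal{S}_{(S,j)}\}$, which is again a trajectory set. The node $\mathcal{S}_{(S,j)}$ is an arbitrage node if there is $\varepsilon\in\{-1,1\}$ with $\varepsilon(\tilde S_{j+1}-S_j)\ge 0$ for all $\tilde S\in\mathcal{S}_{(S,j)}$ and with strict inequality for at least one $\tilde S\in\mathcal{S}_{(S,j)}$; it is of type II if, moreover, $\tilde S_{j+1}\ne S_j$ for all $\tilde S\in\mathcal{S}_{(S,j)}$. The set $\mathcal{S}$ is complete if for every sequence $(S^n)_{n\ge 0}$ in $\mathcal{S}$ with $S^n_i=S^{n+1}_i$ for all $0\le i\le n$, $n\in\mathbb{N}_0$, the sequence $(S^i_i)_{i\ge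 0}$ belongs to $\mathcal{S}$. **Portfolios.** A simple portfolio $(V,n,H)$ consists of $V\in\mathbb{R}$, $n\in\mathbb{N}$, and functions $H_i:\mathcal{S}\to\mathbb{R}$, $0\le i\le n-1$, of the form $H_i(S)=h_i(S_0,\dots,S_i)$ with arbitrary $h_i:\mathbb{R}^{i+1}\to\mathbb{R}$. Its wealth process is $\Pi_j^{V,n,H}(S)=V+\sum_{i=0}^{\min\{j,n\}-1}H_i(S)(S_{i+1}-S_i)$, and $\Pi_\infty^{V,n,H}=\Pi_n^{V,n,H}$. It is positive if $V\ge 0$ and $\Pi_\infty^{V,n,H}\ge 0$ on $\mathcal{S}$. A generalized portfolio is a sequence $(V_m,n_m,H_m)_{m\ge 0}$ of simple portfolios which are positive for $m\ge 1$; it is positive if, in addition, $\Pi_j^{V_0,n_0,H_0}\equiv 0$ for all $j$. It superhedges $f:\mathcal{S}\to[-\infty,+\infty]$ with initial endowment $\sum_{m\ge 0}V_m\in(-\infty,+\infty]$ if $f\le\sum_{m\ge 0}\Pi_\infty^{V_m,n_m,H_m}$ on $\mathcal{S}$. Let $\bar\sigma(f)$ be the infimum of the initial endowments of all generalized portfolios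 that superhedge $f$ and, for $f\ge 0$, let $\bar I(f)$ be the infimum of the initial endowments of all positive generalized portfolios that superhedge $f$. **Conditions.** - (L): $\bar\sigma(0)\ge 0$. - (LOP): two simple portfolios with the same terminal wealth $\Pi_\infty$ on $\mathcal{S}$ have the same initial endowment. In this case $I(\Pi_\infty^{V,n,H})=V$ is well defined on the space $\mathcal{E}$ of terminal wealths of simple portfolios. - (K): (LOP) holds and $I(f)+\bar I(f^-)\le\bar I(f^+)$ for all $f\in\mathcal{E}$, where $f^+=\max\{f,0\}$, $f^-=\max\{-f,0\}$. (nL), respectively (nK), means that (L), respectively (K), holds for the trajectory set $\mathcal{S}^{(S,j)}$ in place of $\mathcal{S}$, for every $S\in\mathcal{S}$ and $j\in\mathbb{N}_0$. **Martingale measures.** Equip $\mathcal{S}$ with the trace $\sigma$-field $\mathfrak{A}$ of the Borel $\sigma$-field of $\mathbb{R}^{\mathbb{N}_0}$. Let $\mathcal{M}_0$ be the set of all probability measures $Q$ on $(\mathcal{S},\mathfrak{A})$ such that the coordinate process $T_i(S)=S_i$, $i\ge 0$, is a $Q$-martingale with respect to its natural filtration, and such that there is $\mathcal{S}'\in\mathfrak{A}$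 with $Q(\mathcal{S}')=1$ for which $\{\mathcal{S}_{(S,j)}:S\in\mathcal{S}'\}$ is finite for every $j\in\mathbb{N}_0$. **Theorem.** If $\mathcal{S}$ is complete and none of the nodes $\mathcal{S}_{(S,j)}$, $S\in\mathcal{S}$, $j\in\mathbb{N}_0$, is an arbitrage node of type II, then $\mathcal{M}_0\neq\emptyset$, and (nL) and (nK) hold. -/

import Mathlib

open MeasureTheory ProbabilityTheory Set
open scoped ENNReal

noncomputable section

namespace ModelFree

/-! ### Nodes and shifted conditional spaces

A trajectory set is a set of real sequences (all with the same initial value). -/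

/-- The conditional space (node) of all trajectories in the set `𝒮` which agree with `S`
up to time `j`. -/
def node (𝒮 : Set (ℕ → ℝ)) (S : ℕ → ℝ) (j : ℕ) : Set (ℕ → ℝ) :=
  {S' | S' ∈ 𝒮 ∧ ∀ i ≤ j, S' i = S i}

/-- The shifted conditional space: the trajectories in the node of `S` at time `j`, restarted at
time `j` with the past thrown away. -/
def shiftedSpace (𝒮 : Set (ℕ → ℝ)) (S : ℕ → ℝ) (j : ℕ) : Set (ℕ → ℝ) :=
  (fun (S' : ℕ → ℝ) (i : ℕ) => S' (j + i)) '' node 𝒮 S j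

/-- A property of trajectory sets holds for `𝒮` at every node, if it holds for each of the shifted
conditional spaces. -/
def AtEveryNode (p : Set (ℕ → ℝ) → Prop) (𝒮 : Set (ℕ → ℝ)) : Prop :=
  ∀ S ∈ 𝒮, ∀ j : ℕ, p (shiftedSpace 𝒮 S j)

/-- The node of `S` at time `j` is an arbitrage node. -/
def IsArbitrageNode (𝒮 : Set (ℕ → ℝ)) (S : ℕ → ℝ) (j : ℕ) : Prop :=
  ∃ ε : ℝ, (ε = 1 ∨ ε = -1) ∧ (∀ S' ∈ node 𝒮 S j, 0 ≤ ε * (S' (j + 1) - S j)) ∧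
    ∃ S' ∈ node 𝒮 S j, 0 < ε * (S' (j + 1) - S j)

/-- An arbitrage node is of type I, if the price may remain unchanged in the next step. -/
def IsArbitrageNodeTypeI (𝒮 : Set (ℕ → ℝ)) (S : ℕ → ℝ) (j : ℕ) : Prop :=
  IsArbitrageNode 𝒮 S j ∧ ∃ S' ∈ node 𝒮 S j, S' (j + 1) = S j

/-- An arbitrage node is of type II, if it is not of type I. -/
def IsArbitrageNodeTypeII (𝒮 : Set (ℕ → ℝ)) (S : ℕ → ℝ) (j : ℕ) : Prop :=
  IsArbitrageNode 𝒮 S j ∧ ¬ IsArbitrageNodeTypeI 𝒮 S j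

/-- Completeness: if `s` is a sequence of trajectories in `𝒮` such that `s n` and `s (n + 1)`
agree up to time `n` for every `n`, then the limit `(s i i)_i` is a trajectory in `𝒮`. -/
def IsCompleteTrajectorySet (𝒮 : Set (ℕ → ℝ)) : Prop :=
  ∀ s : ℕ → ℕ → ℝ, (∀ n, s n ∈ 𝒮) → (∀ n, ∀ i ≤ n, s n i = s (n + 1) i) →
    (fun i => s i i) ∈ 𝒮

/-! ### Portfolios -/

/-- A simple portfolio: initial endowment `V`, maturity `n` and nonanticipating positions `H i`,
held between the times `i` and `i + 1`, for `i < n` (the values of `H i` for `n ≤ i` are never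
used). No measurability is required. -/
structure SimplePortfolio (𝒮 : Set (ℕ → ℝ)) where
  /-- initial endowment -/
  V : ℝ
  /-- maturity -/
  n : ℕ
  /-- number of shares held from time `i` to time `i + 1` -/
  H : ℕ → 𝒮 → ℝ
  /-- `H i` is a function of the prices up to time `i`. -/
  nonanticipating : ∀ i < n, ∃ h : (Fin (i + 1) → ℝ) → ℝ,
    ∀ S : 𝒮, H i S = h (fun k => S.1 k)

namespace SimplePortfolio

variable {𝒮 : Set (ℕ → ℝ)}

/-- The wealth process. -/
def wealth (P : SimplePortfolio 𝒮) (j : ℕ) (S : 𝒮) : ℝ :=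
  P.V + ∑ i ∈ Finset.range (min j P.n), P.H i S * (S.1 (i + 1) - S.1 i)

/-- The terminal wealth, i.e. the (eventually constant) limit of the wealth process. -/
def payoff (P : SimplePortfolio 𝒮) (S : 𝒮) : ℝ := P.wealth P.n S

/-- A positive simple portfolio. -/
def IsPositive (P : SimplePortfolio 𝒮) : Prop := 0 ≤ P.V ∧ ∀ S, 0 ≤ P.payoff S

end SimplePortfolio

/-- A generalized portfolio: a sequence of simple portfolios, of which all but the one with
index zero are positive. -/
structure GeneralizedPortfolio (𝒮 : Set (ℕ → ℝ)) where
  /-- the simple portfolios -/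
  P : ℕ → SimplePortfolio 𝒮
  positive : ∀ m, 1 ≤ m → (P m).IsPositive

namespace GeneralizedPortfolio

variable {𝒮 : Set (ℕ → ℝ)}

/-- A positive generalized portfolio: the wealth process of the portfolio with index zero
vanishes identically. -/
def IsPositive (G : GeneralizedPortfolio 𝒮) : Prop := ∀ j S, (G.P 0).wealth j S = 0

/-- The initial endowment `∑_{m ≥ 0} V_m` in `(-∞, +∞]`; the terms with `m ≥ 1` are nonnegative,
so that their sum may be taken in `[0, +∞]`. -/
def endowment (G : GeneralizedPortfolio 𝒮) : EReal :=
  ((G.P 0).V : EReal) + ((∑' m : ℕ, ENNReal.ofReal (G.P (m + 1)).V : ℝ≥0∞) : EReal)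

/-- The terminal wealth, i.e. the sum over `m ≥ 0` of the terminal wealths of the simple
portfolios, in `(-∞, +∞]`; the terms with `m ≥ 1` are nonnegative, so that their sum may be taken
in `[0, +∞]`. -/
def payoff (G : GeneralizedPortfolio 𝒮) (S : 𝒮) : EReal :=
  ((G.P 0).payoff S : EReal) +
    ((∑' m : ℕ, ENNReal.ofReal ((G.P (m + 1)).payoff S) : ℝ≥0∞) : EReal)

/-- The generalized portfolio superhedges the financial position `f`. -/
def Superhedges (G : GeneralizedPortfolio 𝒮) (f : 𝒮 → EReal) : Prop := ∀ S, f S ≤ G.payoff S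

end GeneralizedPortfolio

/-! ### Superhedging operators, and the conditions of Leinert and König -/

/-- The superhedging operator for positive financial positions, with respect to positive
generalized portfolios. -/
def barI (𝒮 : Set (ℕ → ℝ)) (f : 𝒮 → ℝ≥0∞) : ℝ≥0∞ :=
  sInf {V : ℝ≥0∞ | ∃ G : GeneralizedPortfolio 𝒮, G.IsPositive ∧
    G.Superhedges (fun S => (f S : EReal)) ∧ G.endowment = (V : EReal)}

/-- The superhedging operator for arbitrary financial positions, with respect to generalized
portfolios. -/
def barSigma (𝒮 : Set (ℕ → ℝ)) (f : 𝒮 → EReal) : EReal :=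
  sInf {V : EReal | ∃ G : GeneralizedPortfolio 𝒮, G.Superhedges f ∧ G.endowment = V}

/-- Leinert's condition (L). -/
def Leinert (𝒮 : Set (ℕ → ℝ)) : Prop := 0 ≤ barSigma 𝒮 (fun _ => 0)

/-- The law of one price (LOP) for simple portfolios. It says that the hedging price
`I(f) = V` is well-defined on the space of terminal wealths `f` of simple portfolios. -/
def LawOfOnePrice (𝒮 : Set (ℕ → ℝ)) : Prop :=
  ∀ P P' : SimplePortfolio 𝒮, (∀ S, P'.payoff S = P.payoff S) → P'.V = P.V

/-- König's condition (K): the law of one price holds, so that the hedging price `I` of the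
terminal wealth `f` of a simple portfolio is the initial endowment of this portfolio, and
`I(f) + Ī(f⁻) ≤ Ī(f⁺)` for all such `f`. Here `f⁺ = max f 0` and `f⁻ = max (-f) 0`. -/
def Koenig (𝒮 : Set (ℕ → ℝ)) : Prop :=
  LawOfOnePrice 𝒮 ∧ ∀ P : SimplePortfolio 𝒮,
    (P.V : EReal) + (barI 𝒮 (fun S => ENNReal.ofReal (-P.payoff S)) : EReal) ≤
      (barI 𝒮 (fun S => ENNReal.ofReal (P.payoff S)) : EReal)

/-! ### Martingale measures

A trajectory set carries the trace of the product (= Borel) σ-field on the space of real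
sequences, which is the instance on the subtype. -/

/-- The coordinate process. -/
def coord (𝒮 : Set (ℕ → ℝ)) (i : ℕ) (S : 𝒮) : ℝ := S.1 i

theorem stronglyMeasurable_coord (𝒮 : Set (ℕ → ℝ)) (i : ℕ) : StronglyMeasurable (coord 𝒮 i) :=
  ((measurable_pi_apply i).comp measurable_subtype_coe).stronglyMeasurable

/-- Probability measures under which the coordinate process is a martingale with respect to its
natural filtration. -/
def martingaleMeasures (𝒮 : Set (ℕ → ℝ)) : Set (Measure 𝒮) :=
  {Q | IsProbabilityMeasure Q ∧
    Martingale (coord 𝒮) (Filtration.natural (coord 𝒮) (stronglyMeasurable_coord 𝒮)) Q}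

/-- Martingale measures with finite support at finite maturities: some measurable set of full
measure passes through only finitely many nodes at each time. -/
def finiteSupportMartingaleMeasures (𝒮 : Set (ℕ → ℝ)) : Set (Measure 𝒮) :=
  {Q | Q ∈ martingaleMeasures 𝒮 ∧ ∃ A : Set 𝒮, MeasurableSet A ∧ Q A = 1 ∧
    ∀ j : ℕ, ((fun S : 𝒮 => node 𝒮 S.1 j) '' A).Finite}

end ModelFree

end

noncomputable section

namespace ModelFree

variable {𝒮 : Set (ℕ → ℝ)}

/-! ### Nodes at which the next move may be chosen with a prescribed sign -/

/-! Without type II nodes, every node is `Balanced`: either the price can move both ways, or it can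
stay put. Hence any strategy can be met by a next move on which it gains nothing, and completeness
glues these moves into a trajectory (`Balanced.exists_descending`). Both hypotheses pass to shifted
spaces, so (L) and (K) need only be shown for one set.

For (L) this is applied to the sum of all positions of a generalized portfolio. The difficulty is
convergence. Positive portfolios have nonnegative wealth at all times; where both directions are
possible, this bounds a position by a constant times the wealth, so summability survives each good
step (`hasSum_wealth_succ`). Total wealth then cannot increase along the chosen trajectory, which
yields `exists_tsum_payoff_le`.

For (K), let portfolios `Q m` superhedge the positive part of the payoff of `P`. Their total
position minus that of `P`, stopped at the first arbitrage gain, hedges the negative part on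
trajectories of good steps (`exists_hedge_negPart`). All others are covered at no cost by infinitely
many copies of an arbitrage portfolio.

For a martingale measure, each node gets a mean-preserving law on at most two successors. The
Ionescu-Tulcea measure of the resulting binary tree is pushed forward to trajectories. -/

/-- Two trajectories agree up to time `j`. -/
def AgreeUpTo (j : ℕ) (S T : 𝒮) : Prop := ∀ i ≤ j, T.1 i = S.1 i

theorem AgreeUpTo.refl (j : ℕ) (S : 𝒮) : AgreeUpTo j S S := fun _ _ => rfl

theorem AgreeUpTo.symm {j : ℕ} {S T : 𝒮} (h : AgreeUpTo j S T) : AgreeUpTo j T S :=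
  fun i hi => (h i hi).symm

theorem AgreeUpTo.trans {j : ℕ} {S T U : 𝒮} (h : AgreeUpTo j S T) (h' : AgreeUpTo j T U) :
    AgreeUpTo j S U := fun i hi => (h' i hi).trans (h i hi)

theorem AgreeUpTo.mono {i j : ℕ} {S T : 𝒮} (h : AgreeUpTo j S T) (hij : i ≤ j) :
    AgreeUpTo i S T := fun k hk => h k (hk.trans hij)

/-- The price may move strictly up and strictly down in the next step. -/
def TwoSided (i : ℕ) (S : 𝒮) : Prop :=
  (∃ T, AgreeUpTo i S T ∧ S.1 i < T.1 (i + 1)) ∧ ∃ T, AgreeUpTo i S T ∧ T.1 (i + 1) < S.1 i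

theorem AgreeUpTo.twoSided {i : ℕ} {S T : 𝒮} (h : AgreeUpTo i S T) (hS : TwoSided i S) :
    TwoSided i T := by
  obtain ⟨⟨U, hU, hU'⟩, W, hW, hW'⟩ := hS
  have := h i le_rfl
  exact ⟨⟨U, h.symm.trans hU, by rwa [this]⟩, W, h.symm.trans hW, by rwa [this]⟩

theorem AgreeUpTo.twoSided_iff {i : ℕ} {S T : 𝒮} (h : AgreeUpTo i S T) :
    TwoSided i T ↔ TwoSided i S := ⟨h.symm.twoSided, h.twoSided⟩

/-- At every node the price may move in both directions, or remain unchanged. -/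
def Balanced (𝒮 : Set (ℕ → ℝ)) : Prop :=
  ∀ (S : 𝒮) (i : ℕ), TwoSided i S ∨ ∃ T, AgreeUpTo i S T ∧ T.1 (i + 1) = S.1 i

theorem balanced_of_not_typeII (h : ∀ S ∈ 𝒮, ∀ j : ℕ, ¬ IsArbitrageNodeTypeII 𝒮 S j) :
    Balanced 𝒮 := by
  intro S i
  by_contra! hcon
  obtain ⟨h2, hflat⟩ := hcon
  -- If `S` moves in direction `ε` and nothing moves against it, the node is an arbitrage node, of
  -- type II because no flat continuation exists.
  have key : ∀ ε : ℝ, (ε = 1 ∨ ε = -1) → 0 < ε * (S.1 (i + 1) - S.1 i) →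
      ∃ T, AgreeUpTo i S T ∧ ε * (T.1 (i + 1) - S.1 i) < 0 := by
    intro ε hε hpos
    by_contra! hall
    refine h S.1 S.2 i ⟨⟨ε, hε, fun S' hS' => hall ⟨S', hS'.1⟩ hS'.2,
      S.1, ⟨S.2, fun _ _ => rfl⟩, hpos⟩, ?_⟩
    rintro ⟨-, S', hS', he⟩
    exact hflat ⟨S', hS'.1⟩ hS'.2 he
  rcases lt_trichotomy (S.1 (i + 1)) (S.1 i) with hlt | heq | hgt
  · obtain ⟨T, hT, hT'⟩ := key (-1) (Or.inr rfl) (by linarith)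
    exact h2 ⟨⟨T, hT, by linarith⟩, S, AgreeUpTo.refl i S, hlt⟩
  · exact hflat S (AgreeUpTo.refl i S) heq
  · obtain ⟨T, hT, hT'⟩ := key 1 (Or.inl rfl) (by linarith)
    exact h2 ⟨⟨S, AgreeUpTo.refl i S, hgt⟩, T, hT, by linarith⟩

theorem Balanced.shiftedSpace (hb : Balanced 𝒮) (S : ℕ → ℝ) (j : ℕ) :
    Balanced (shiftedSpace 𝒮 S j) := by
  have lift : ∀ (U : 𝒮) (hU : U.1 ∈ node 𝒮 S j) (i : ℕ) (T : 𝒮), AgreeUpTo (j + i) U T →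
      ∃ hT : (fun k => T.1 (j + k)) ∈ ModelFree.shiftedSpace 𝒮 S j,
        AgreeUpTo i (⟨fun k => U.1 (j + k), U.1, hU, rfl⟩ : ModelFree.shiftedSpace 𝒮 S j)
          ⟨_, hT⟩ := by
    intro U hU i T hT
    exact ⟨⟨T.1, ⟨T.2, fun k hk => (hT k (by omega)).trans (hU.2 k hk)⟩, rfl⟩,
      fun k hk => hT _ (by omega)⟩
  rintro ⟨_, U, hU, rfl⟩ i
  rcases hb ⟨U, hU.1⟩ (j + i) with ⟨⟨T, hT, hT'⟩, W, hW, hW'⟩ | ⟨T, hT, hT'⟩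
  · obtain ⟨h1, h1'⟩ := lift ⟨U, hU.1⟩ hU i T hT
    obtain ⟨h2, h2'⟩ := lift ⟨U, hU.1⟩ hU i W hW
    exact Or.inl ⟨⟨_, h1', hT'⟩, _, h2', hW'⟩
  · obtain ⟨h1, h1'⟩ := lift ⟨U, hU.1⟩ hU i T hT
    exact Or.inr ⟨_, h1', hT'⟩

theorem IsCompleteTrajectorySet.shiftedSpace (hc : IsCompleteTrajectorySet 𝒮) (S : ℕ → ℝ)
    (j : ℕ) : IsCompleteTrajectorySet (shiftedSpace 𝒮 S j) := by
  intro t ht hagree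
  choose s hs hst using ht
  have hst' : ∀ n i, t n i = s n (j + i) := fun n i => (congrFun (hst n) i).symm
  -- Truncated subtraction repeats `s 0` up to time `j`; all lifts share the past of `S` there.
  have hlim := hc (fun m => s (m - j)) (fun m => (hs _).1) (by
    intro m i hi
    rcases le_or_gt i j with hij | hij
    · exact ((hs _).2 i hij).trans ((hs _).2 i hij).symm
    · obtain ⟨k, rfl⟩ := Nat.exists_eq_add_of_le hij.le
      have h := hagree (m - j) k (by omega)
      rw [hst', hst'] at h
      simpa [Nat.sub_add_comm (show j ≤ m by omega)] using h)
  refine ⟨_, ⟨hlim, fun i hi => (hs _).2 i hi⟩, ?_⟩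
  funext i
  simp [hst']

/-! ### Limits and descending paths -/

theorem IsCompleteTrajectorySet.exists_limit (hc : IsCompleteTrajectorySet 𝒮) (s : ℕ → 𝒮)
    (hs : ∀ n, AgreeUpTo n (s n) (s (n + 1))) : ∃ L : 𝒮, ∀ n, AgreeUpTo n (s n) L := by
  refine ⟨⟨_, hc (fun n => (s n).1) (fun n => (s n).2) fun n i hi => (hs n i hi).symm⟩, ?_⟩
  intro n i hi
  change (s i).1 i = (s n).1 i
  induction n, hi using Nat.le_induction with
  | base => rfl
  | succ n hn ih => rw [ih, hs n i hn]

/-- A process which depends only on the prices up to the present time. -/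
def Nonanticipating (G : ℕ → 𝒮 → ℝ) : Prop := ∀ i S T, AgreeUpTo i S T → G i T = G i S

/-- The step of `S` from time `i` to time `i + 1` is no arbitrage gain: the price may move in both
directions, or it remains unchanged. -/
def GoodStep (i : ℕ) (S : 𝒮) : Prop := TwoSided i S ∨ S.1 (i + 1) = S.1 i

theorem AgreeUpTo.goodStep {i : ℕ} {S T : 𝒮} (h : AgreeUpTo (i + 1) S T) (hS : GoodStep i S) :
    GoodStep i T :=
  hS.imp (h.mono i.le_succ).twoSided fun h' => by
    rw [h _ le_rfl, h _ i.le_succ, h']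

theorem Balanced.exists_step (hb : Balanced 𝒮) {G : ℕ → 𝒮 → ℝ} (hG : Nonanticipating G)
    (i : ℕ) (S : 𝒮) : ∃ T, AgreeUpTo i S T ∧ GoodStep i T ∧
      G i T * (T.1 (i + 1) - T.1 i) ≤ 0 := by
  rcases hb S i with h2 | ⟨T, hT, hT'⟩
  · obtain ⟨⟨U, hU, hU'⟩, W, hW, hW'⟩ := id h2
    rcases le_total 0 (G i S) with h | h
    · refine ⟨W, hW, Or.inl (hW.twoSided h2), ?_⟩
      rw [hG i S W hW, hW i le_rfl]
      exact mul_nonpos_of_nonneg_of_nonpos h (by linarith)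
    · refine ⟨U, hU, Or.inl (hU.twoSided h2), ?_⟩
      rw [hG i S U hU, hU i le_rfl]
      exact mul_nonpos_of_nonpos_of_nonneg h (by linarith)
  · have : T.1 (i + 1) = T.1 i := by rw [hT', hT i le_rfl]
    exact ⟨T, hT, Or.inr this, by simp [this]⟩

/-- From every node one may follow a trajectory along which the gains of a given trading strategy
never increase. -/
theorem Balanced.exists_descending (hb : Balanced 𝒮) (hc : IsCompleteTrajectorySet 𝒮)
    {G : ℕ → 𝒮 → ℝ} (hG : Nonanticipating G) (j : ℕ) (S : 𝒮) :
    ∃ T, AgreeUpTo j S T ∧ ∀ i, j ≤ i → GoodStep i T ∧ G i T * (T.1 (i + 1) - T.1 i) ≤ 0 := by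
  choose next hnext hgood hle using hb.exists_step hG
  -- The sequence waits at `S` until time `j`, so that its index is the time.
  let s : ℕ → 𝒮 := fun m => Nat.rec S (fun m T => if m < j then T else next m T) m
  have hs0 : s 0 = S := rfl
  have hs : ∀ m, s (m + 1) = if m < j then s m else next m (s m) := fun m => rfl
  have hsj : ∀ m ≤ j, s m = S := by
    intro m
    induction m with
    | zero => exact fun _ => hs0
    | succ m ih => exact fun h => by rw [hs, if_pos (by omega), ih (by omega)]
  obtain ⟨L, hL⟩ := hc.exists_limit s fun m => by
    rw [hs]
    split_ifs
    · exact AgreeUpTo.refl _ _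
    · exact hnext _ _
  refine ⟨L, hsj j le_rfl ▸ hL j, fun i hi => ?_⟩
  have h := hL (i + 1)
  rw [hs, if_neg (by omega)] at h
  refine ⟨h.goodStep (hgood _ _), ?_⟩
  rw [hG i _ _ (h.mono i.le_succ), h _ le_rfl, h _ i.le_succ]
  exact hle _ _

/-! ### Wealth processes of simple portfolios -/

namespace SimplePortfolio

/-- The position held from time `i` to time `i + 1`, which is zero from the maturity on. -/
def position (P : SimplePortfolio 𝒮) (i : ℕ) (S : 𝒮) : ℝ := if i < P.n then P.H i S else 0

theorem nonanticipating_position (P : SimplePortfolio 𝒮) : Nonanticipating P.position := by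
  intro i S T h
  unfold position
  split_ifs with hi
  · obtain ⟨g, hg⟩ := P.nonanticipating i hi
    rw [hg, hg]
    congr 1
    funext k
    exact h k (by omega)
  · rfl

@[simp]
theorem wealth_zero (P : SimplePortfolio 𝒮) (S : 𝒮) : P.wealth 0 S = P.V := by simp [wealth]

theorem wealth_succ (P : SimplePortfolio 𝒮) (j : ℕ) (S : 𝒮) :
    P.wealth (j + 1) S = P.wealth j S + P.position j S * (S.1 (j + 1) - S.1 j) := by
  unfold wealth position
  split_ifs with h
  · rw [min_eq_left (by omega), min_eq_left (by omega), Finset.sum_range_succ, add_assoc]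
  · rw [min_eq_right (by omega), min_eq_right (by omega)]
    ring

theorem wealth_of_le (P : SimplePortfolio 𝒮) {j : ℕ} (h : P.n ≤ j) (S : 𝒮) :
    P.wealth j S = P.payoff S := by
  simp [payoff, wealth, h]

theorem wealth_congr (P : SimplePortfolio 𝒮) {j : ℕ} {S T : 𝒮} (h : AgreeUpTo j S T) :
    P.wealth j T = P.wealth j S := by
  induction j with
  | zero => simp
  | succ j ih =>
    have h' := h.mono j.le_succ
    rw [wealth_succ, wealth_succ, ih h', P.nonanticipating_position _ _ _ h', h _ le_rfl,
      h _ j.le_succ]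

theorem payoff_congr (P : SimplePortfolio 𝒮) {S T : 𝒮} (h : AgreeUpTo P.n S T) :
    P.payoff T = P.payoff S := P.wealth_congr h

/-- Every nonanticipating process consists of the positions of a simple portfolio. -/
theorem exists_of_position {G : ℕ → 𝒮 → ℝ} (hG : Nonanticipating G) (V : ℝ) (n : ℕ) :
    ∃ P : SimplePortfolio 𝒮, P.V = V ∧ P.n = n ∧ P.H = G := by
  classical
  refine ⟨⟨V, n, G, fun i _ => ?_⟩, rfl, rfl, rfl⟩
  -- The position is read off any trajectory with prefix `x`; nonanticipation makes the choice
  -- immaterial.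
  refine ⟨fun x => if h : ∃ T : 𝒮, (fun k : Fin (i + 1) => T.1 k) = x then G i h.choose else 0,
    fun S => ?_⟩
  have h : ∃ T : 𝒮, (fun k : Fin (i + 1) => T.1 k) = fun k : Fin (i + 1) => S.1 k := ⟨S, rfl⟩
  beta_reduce
  rw [dif_pos h]
  refine (hG i S _ fun k hk => ?_).symm
  exact congrFun h.choose_spec ⟨k, by omega⟩

theorem wealth_antitone_of_descending (P : SimplePortfolio 𝒮) {T : 𝒮} {j : ℕ}
    (h : ∀ i, j ≤ i → P.position i T * (T.1 (i + 1) - T.1 i) ≤ 0) {k : ℕ} (hk : j ≤ k) :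
    P.wealth k T ≤ P.wealth j T := by
  induction k, hk using Nat.le_induction with
  | base => rfl
  | succ k hk ih => rw [wealth_succ]; linarith [h k hk]

theorem exists_payoff_le_wealth (hb : Balanced 𝒮) (hc : IsCompleteTrajectorySet 𝒮)
    (P : SimplePortfolio 𝒮) (j : ℕ) (S : 𝒮) :
    ∃ T, AgreeUpTo j S T ∧ (∀ i, j ≤ i → GoodStep i T) ∧ P.payoff T ≤ P.wealth j S := by
  obtain ⟨T, hT, hT'⟩ := hb.exists_descending hc P.nonanticipating_position j S
  refine ⟨T, hT, fun i hi => (hT' i hi).1, ?_⟩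
  rw [← P.wealth_congr hT, ← P.wealth_of_le (le_max_right j P.n)]
  exact P.wealth_antitone_of_descending (fun i hi => (hT' i hi).2) (le_max_left _ _)

/-- From a node with negative wealth, a descending path would lead to a negative payoff. -/
theorem IsPositive.wealth_nonneg {P : SimplePortfolio 𝒮} (hP : P.IsPositive) (hb : Balanced 𝒮)
    (hc : IsCompleteTrajectorySet 𝒮) (j : ℕ) (S : 𝒮) : 0 ≤ P.wealth j S := by
  obtain ⟨T, -, -, h⟩ := P.exists_payoff_le_wealth hb hc j S
  exact (hP.2 T).trans h

/-- At a two-sided node, nonnegative wealth after one fixed up move and one fixed down move bounds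
each position from both sides by a multiple of the wealth. On a flat step the positions do not
matter, summable or not. -/
theorem hasSum_wealth_succ (hb : Balanced 𝒮) (hc : IsCompleteTrajectorySet 𝒮)
    {Q : ℕ → SimplePortfolio 𝒮} (hQ : ∀ m, (Q m).IsPositive) {i : ℕ} {S : 𝒮}
    (hS : GoodStep i S) (hsum : Summable fun m => (Q m).wealth i S) :
    HasSum (fun m => (Q m).wealth (i + 1) S)
      (∑' m, (Q m).wealth i S + (∑' m, (Q m).position i S) * (S.1 (i + 1) - S.1 i)) := by
  rcases hS with h2 | hflat
  · obtain ⟨⟨U, hU, hU'⟩, W, hW, hW'⟩ := h2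
    have bound : ∀ T, AgreeUpTo i S T → ∀ m,
        0 ≤ (Q m).wealth i S + (Q m).position i S * (T.1 (i + 1) - S.1 i) := by
      intro T hT m
      have := (hQ m).wealth_nonneg hb hc (i + 1) T
      rwa [wealth_succ, (Q m).wealth_congr hT, (Q m).nonanticipating_position _ _ _ hT,
        hT i le_rfl] at this
    have hpos : Summable fun m => (Q m).position i S := by
      set u := U.1 (i + 1) - S.1 i
      set w := S.1 i - W.1 (i + 1)
      have hu : 0 < u := by simp only [u]; linarith
      have hw : 0 < w := by simp only [w]; linarith
      refine Summable.of_norm_bounded (hsum.mul_left (u⁻¹ + w⁻¹)) fun m => ?_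
      have h0 : 0 ≤ (Q m).wealth i S := (hQ m).wealth_nonneg hb hc i S
      have h1 : 0 ≤ (Q m).wealth i S + (Q m).position i S * u := bound U hU m
      have h2 : 0 ≤ (Q m).wealth i S - (Q m).position i S * w := by
        have := bound W hW m
        simp only [w]
        linarith
      have h3 : -(u⁻¹ * (Q m).wealth i S) ≤ (Q m).position i S := by
        rw [inv_mul_eq_div, ← neg_div, div_le_iff₀ hu]
        linarith
      have h4 : (Q m).position i S ≤ w⁻¹ * (Q m).wealth i S := by
        rw [inv_mul_eq_div, le_div_iff₀ hw]
        linarith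
      have h5 : 0 ≤ u⁻¹ * (Q m).wealth i S := by positivity
      have h6 : 0 ≤ w⁻¹ * (Q m).wealth i S := by positivity
      rw [Real.norm_eq_abs, abs_le]
      constructor <;> linarith
    simp only [wealth_succ]
    exact hsum.hasSum.add (hpos.hasSum.mul_right _)
  · simp only [wealth_succ, hflat, sub_self, mul_zero, add_zero]
    exact hsum.hasSum

/-- The total wealth of a simple portfolio and of countably many positive ones at a node is at
least their total payoff along some trajectory through this node. -/
theorem exists_tsum_payoff_le (hb : Balanced 𝒮) (hc : IsCompleteTrajectorySet 𝒮)
    (P : SimplePortfolio 𝒮) {Q : ℕ → SimplePortfolio 𝒮} (hQ : ∀ m, (Q m).IsPositive) (j : ℕ)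
    (S : 𝒮) (hsum : Summable fun m => (Q m).wealth j S) :
    ∃ T, AgreeUpTo j S T ∧ (Summable fun m => (Q m).payoff T) ∧
      P.payoff T + ∑' m, (Q m).payoff T ≤ P.wealth j S + ∑' m, (Q m).wealth j S := by
  obtain ⟨T, hT, hdesc⟩ := hb.exists_descending hc
    (G := fun i S => P.position i S + ∑' m, (Q m).position i S) (by
      intro i S T h
      simp only [P.nonanticipating_position i S T h,
        fun m => (Q m).nonanticipating_position i S T h]) j S
  have hw : ∀ k, j ≤ k → (Summable fun m => (Q m).wealth k T) ∧
      P.wealth k T + ∑' m, (Q m).wealth k T ≤ P.wealth j S + ∑' m, (Q m).wealth j S := by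
    intro k hk
    induction k, hk using Nat.le_induction with
    | base => simp only [P.wealth_congr hT, fun m => (Q m).wealth_congr hT]; exact ⟨hsum, le_rfl⟩
    | succ k hk ih =>
      have h := hasSum_wealth_succ hb hc hQ (hdesc k hk).1 ih.1
      refine ⟨h.summable, ?_⟩
      rw [h.tsum_eq, wealth_succ]
      linarith [ih.2, (hdesc k hk).2]
  have hfin : ∀ F : Finset ℕ, ∑ m ∈ F, (Q m).payoff T ≤
      P.wealth j S + ∑' m, (Q m).wealth j S - P.payoff T := by
    intro F
    -- Infinitely many maturities may be unbounded, so only finite partial sums can be compared at a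
    -- common time.
    set k := max (max j P.n) (F.sup fun m => (Q m).n)
    obtain ⟨h1, h2⟩ := hw k (by simp [k])
    rw [P.wealth_of_le (by simp [k])] at h2
    have h3 : ∑ m ∈ F, (Q m).payoff T = ∑ m ∈ F, (Q m).wealth k T := by
      refine Finset.sum_congr rfl fun m hm => ((Q m).wealth_of_le ?_ T).symm
      exact (Finset.le_sup (f := fun m => (Q m).n) hm).trans (le_max_right _ _)
    have h4 := h1.sum_le_tsum F fun m _ => (hQ m).wealth_nonneg hb hc k T
    linarith
  refine ⟨T, hT, summable_of_sum_le (fun m => (hQ m).2 T) hfin, ?_⟩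
  have := Real.tsum_le_of_sum_le (fun m => (hQ m).2 T) hfin
  linarith

end SimplePortfolio

/-! ### Leinert's condition and the law of one price -/

theorem leinert_of_balanced (hne : 𝒮.Nonempty) (hb : Balanced 𝒮)
    (hc : IsCompleteTrajectorySet 𝒮) : Leinert 𝒮 := by
  refine le_sInf ?_
  rintro _ ⟨G, hG, rfl⟩
  obtain ⟨S₀, hS₀⟩ := hne
  have hQ : ∀ m, (G.P (m + 1)).IsPositive := fun m => G.positive _ (by omega)
  by_cases hV : ∑' m, ENNReal.ofReal (G.P (m + 1)).V = ⊤
  · simp [GeneralizedPortfolio.endowment, hV]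
  have hsum : Summable fun m => (G.P (m + 1)).V := by
    have := ENNReal.summable_toReal hV
    simpa only [ENNReal.toReal_ofReal (hQ _).1] using this
  obtain ⟨T, -, hT, hle⟩ := SimplePortfolio.exists_tsum_payoff_le hb hc (G.P 0) hQ 0 ⟨S₀, hS₀⟩
    (by simpa using hsum)
  have h : (0 : EReal) ≤ G.payoff T := hG T
  rw [GeneralizedPortfolio.payoff, ← ENNReal.ofReal_tsum_of_nonneg (fun m => (hQ m).2 T) hT] at h
  rw [GeneralizedPortfolio.endowment, ← ENNReal.ofReal_tsum_of_nonneg (fun m => (hQ m).1) hsum]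
  rw [EReal.coe_ennreal_ofReal, max_eq_left (tsum_nonneg fun m => (hQ m).2 T)] at h
  rw [EReal.coe_ennreal_ofReal, max_eq_left (tsum_nonneg fun m => (hQ m).1)]
  simp only [SimplePortfolio.wealth_zero] at hle
  norm_cast at h ⊢
  linarith

/-- Along a path descending for the difference of the two strategies, the difference of wealths
never increases, and it ends at zero. -/
theorem lawOfOnePrice_of_balanced (hne : 𝒮.Nonempty) (hb : Balanced 𝒮)
    (hc : IsCompleteTrajectorySet 𝒮) : LawOfOnePrice 𝒮 := by
  have key : ∀ P P' : SimplePortfolio 𝒮, (∀ S, P'.payoff S = P.payoff S) → P'.V ≤ P.V := by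
    intro P P' h
    obtain ⟨S₀, hS₀⟩ := hne
    obtain ⟨T, -, hT⟩ := hb.exists_descending hc
      (G := fun i S => P.position i S - P'.position i S) (by
        intro i S T h
        simp only [P.nonanticipating_position i S T h, P'.nonanticipating_position i S T h])
      0 ⟨S₀, hS₀⟩
    have hk : ∀ k, P.wealth k T - P'.wealth k T ≤ P.V - P'.V := by
      intro k
      induction k with
      | zero => simp
      | succ k ih =>
        rw [SimplePortfolio.wealth_succ, SimplePortfolio.wealth_succ]
        linarith [(hT k k.zero_le).2]
    have := hk (max P.n P'.n)
    rw [P.wealth_of_le (le_max_left _ _), P'.wealth_of_le (le_max_right _ _), h] at this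
    linarith
  exact fun P P' h => le_antisymm (key P P' h) (key P' P fun S => (h S).symm)

/-! ### König's condition -/

namespace SimplePortfolio

/-- There is a positive portfolio without initial endowment which makes a strict profit along
every trajectory with an arbitrage gain before time `n`. -/
theorem exists_arbitrage (𝒮 : Set (ℕ → ℝ)) (n : ℕ) : ∃ N : SimplePortfolio 𝒮, N.V = 0 ∧
    (∀ S, 0 ≤ N.payoff S) ∧ ∀ S, (∃ i < n, ¬ GoodStep i S) → 0 < N.payoff S := by
  classical
  let Up : ℕ → 𝒮 → Prop := fun i S => ∃ T, AgreeUpTo i S T ∧ S.1 i < T.1 (i + 1)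
  have hUp : ∀ i S T, AgreeUpTo i S T → (Up i T ↔ Up i S) := by
    intro i S T h
    simp only [Up, h i le_rfl]
    exact ⟨fun ⟨U, hU, h'⟩ => ⟨U, h.trans hU, h'⟩, fun ⟨U, hU, h'⟩ => ⟨U, h.symm.trans hU, h'⟩⟩
  -- Where the price cannot move both ways, betting on the possible direction earns the absolute
  -- price change.
  let G : ℕ → 𝒮 → ℝ := fun i S => if TwoSided i S then 0 else if Up i S then 1 else -1
  have hG : Nonanticipating G := by
    intro i S T h
    simp only [G, h.twoSided_iff, hUp i S T h]
  obtain ⟨N, hV, hn, hH⟩ := exists_of_position hG 0 n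
  have hpay : ∀ S, N.payoff S = ∑ i ∈ Finset.range n, G i S * (S.1 (i + 1) - S.1 i) := by
    intro S
    simp [payoff, wealth, hV, hn, hH]
  have hterm : ∀ i S, 0 ≤ G i S * (S.1 (i + 1) - S.1 i) ∧
      (¬ GoodStep i S → 0 < G i S * (S.1 (i + 1) - S.1 i)) := by
    intro i S
    have key : ¬ TwoSided i S → G i S * (S.1 (i + 1) - S.1 i) = |S.1 (i + 1) - S.1 i| := by
      intro h2
      simp only [G, if_neg h2]
      split_ifs with hu
      · have : S.1 i ≤ S.1 (i + 1) := by
          by_contra! hlt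
          exact h2 ⟨hu, S, AgreeUpTo.refl i S, hlt⟩
        rw [abs_of_nonneg (by linarith), one_mul]
      · have : S.1 (i + 1) ≤ S.1 i := by
          by_contra! hlt
          exact hu ⟨S, AgreeUpTo.refl i S, hlt⟩
        rw [abs_of_nonpos (by linarith), neg_one_mul]
    by_cases h2 : TwoSided i S
    · exact ⟨by simp [G, h2], fun h => absurd (Or.inl h2) h⟩
    · rw [key h2]
      exact ⟨abs_nonneg _, fun h => abs_pos.2 (sub_ne_zero.2 fun h' => h (Or.inr h'))⟩
  refine ⟨N, hV, fun S => ?_, ?_⟩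
  · rw [hpay]
    exact Finset.sum_nonneg fun i _ => (hterm i S).1
  · rintro S ⟨i, hi, hbad⟩
    rw [hpay]
    exact Finset.sum_pos' (fun i _ => (hterm i S).1) ⟨i, Finset.mem_range.2 hi, (hterm i S).2 hbad⟩

/-- If countably many positive portfolios with finite total endowment superhedge the positive part
of the payoff of `P`, then a simple portfolio superhedges the negative part, for the difference of
the endowments, except where there is an arbitrage gain. -/
theorem exists_hedge_negPart (hb : Balanced 𝒮) (hc : IsCompleteTrajectorySet 𝒮)
    (P : SimplePortfolio 𝒮) {Q : ℕ → SimplePortfolio 𝒮} (hQ : ∀ m, (Q m).IsPositive)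
    (hsum : Summable fun m => (Q m).V)
    (hhedge : ∀ S, (Summable fun m => (Q m).payoff S) →
      max (P.payoff S) 0 ≤ ∑' m, (Q m).payoff S) :
    ∃ R : SimplePortfolio 𝒮, R.V = ∑' m, (Q m).V - P.V ∧ (∀ S, 0 ≤ R.payoff S) ∧
      ∀ S, (∀ i < P.n, GoodStep i S) → -P.payoff S ≤ R.payoff S := by
  classical
  -- The position also vanishes at nodes that are not two-sided: a good step there is flat, and a
  -- bad one must not affect the wealth.
  let G : ℕ → 𝒮 → ℝ := fun i S => if (∀ k < i, GoodStep k S) ∧ TwoSided i S then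
    ∑' m, (Q m).position i S - P.position i S else 0
  have hgood : ∀ (i : ℕ) (S T : 𝒮), AgreeUpTo i S T →
      ((∀ k < i, GoodStep k T) ↔ ∀ k < i, GoodStep k S) :=
    fun i S T h => ⟨fun h' k hk => (h.symm.mono hk).goodStep (h' k hk),
      fun h' k hk => (h.mono hk).goodStep (h' k hk)⟩
  have hG : Nonanticipating G := by
    intro i S T h
    simp only [G, h.twoSided_iff, hgood i S T h, P.nonanticipating_position i S T h,
      fun m => (Q m).nonanticipating_position i S T h]
  obtain ⟨R, hV, hn, hH⟩ := exists_of_position hG (∑' m, (Q m).V - P.V) P.n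
  have hpos : ∀ i < P.n, ∀ S, R.position i S = G i S := by
    intro i hi S
    simp [position, hn, hi, hH]
  have hwealth : ∀ S, ∀ i ≤ P.n, (∀ k < i, GoodStep k S) →
      (Summable fun m => (Q m).wealth i S) ∧
        R.wealth i S = ∑' m, (Q m).wealth i S - P.wealth i S := by
    intro S i
    induction i with
    | zero => exact fun _ _ => by simpa [hV] using hsum
    | succ i ih =>
      intro hi hS
      have hSi : ∀ k < i, GoodStep k S := fun k hk => hS k (by omega)
      obtain ⟨h1, h2⟩ := ih (by omega) hSi
      have h := hasSum_wealth_succ hb hc hQ (hS i (by omega)) h1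
      refine ⟨h.summable, ?_⟩
      rw [h.tsum_eq, wealth_succ, wealth_succ, h2, hpos i (by omega)]
      rcases hS i (by omega) with h3 | h3
      · simp only [G, if_pos (And.intro hSi h3)]
        ring
      · rw [h3]
        ring
  have hgoodpay : ∀ S, (∀ i < P.n, GoodStep i S) → 0 ≤ R.payoff S ∧ -P.payoff S ≤ R.payoff S := by
    intro S hS
    obtain ⟨h1, h2⟩ := hwealth S P.n le_rfl hS
    -- The hedge is used on `T`, where the payoffs are summable; `P` and `S` see no difference up to
    -- `P.n`.
    obtain ⟨T, hT, hT', hle⟩ := exists_tsum_payoff_le hb hc P hQ P.n S h1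
    have h3 := hhedge T hT'
    rw [P.payoff_congr hT] at h3 hle
    have h4 : R.payoff S = ∑' m, (Q m).wealth P.n S - P.payoff S := by
      rw [← R.wealth_of_le hn.le, h2]
      rfl
    have h5 : P.wealth P.n S = P.payoff S := rfl
    have := le_max_left (P.payoff S) 0
    have := le_max_right (P.payoff S) 0
    constructor <;> linarith
  refine ⟨R, hV, fun S => ?_, fun S hS => (hgoodpay S hS).2⟩
  by_cases hS : ∀ i < P.n, GoodStep i S
  · exact (hgoodpay S hS).1
  · push Not at hS
    let i := Nat.find hS
    obtain ⟨hi, hbad⟩ : i < P.n ∧ ¬ GoodStep i S := Nat.find_spec hS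
    have hbefore : ∀ k < i, GoodStep k S := by
      intro k hk
      by_contra h
      exact Nat.find_min hS hk ⟨hk.trans hi, h⟩
    have hconst : ∀ k, i ≤ k → R.wealth k S = R.wealth i S := by
      intro k hk
      induction k, hk using Nat.le_induction with
      | base => rfl
      | succ k hk ih =>
        have : R.position k S = 0 := by
          by_cases hkn : k < P.n
          · rw [hpos k hkn]
            refine if_neg ?_
            rintro ⟨h1, h2⟩
            rcases hk.eq_or_lt with rfl | hlt
            · exact hbad (Or.inl h2)
            · exact hbad (h1 i hlt)
          · simp [position, hn, hkn]
        rw [wealth_succ, ih, this]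
        ring
    -- The frozen wealth dominates the payoff along a continuation from time `i` with good steps
    -- only, which is nonnegative.
    obtain ⟨T, hT, hTgood, hle⟩ := R.exists_payoff_le_wealth hb hc i S
    have h0 := (hgoodpay T fun k _ => by
      rcases lt_or_ge k i with hk | hk
      · exact (hgood i S T hT).2 hbefore k hk
      · exact hTgood k hk).1
    rw [← R.wealth_of_le hn.le, hconst _ hi.le]
    exact h0.trans hle

end SimplePortfolio

theorem barI_negPart_le (hne : 𝒮.Nonempty) (hb : Balanced 𝒮) (hc : IsCompleteTrajectorySet 𝒮)
    (P : SimplePortfolio 𝒮) {v : ℝ≥0∞} {G : GeneralizedPortfolio 𝒮} (hG : G.IsPositive)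
    (hhedge : G.Superhedges fun S => (ENNReal.ofReal (P.payoff S) : EReal))
    (hv : G.endowment = (v : EReal)) :
    (P.V : EReal) + (barI 𝒮 (fun S => ENNReal.ofReal (-P.payoff S)) : EReal) ≤ (v : EReal) := by
  obtain ⟨S₀, hS₀⟩ := hne
  have hQ : ∀ m, (G.P (m + 1)).IsPositive := fun m => G.positive _ (by omega)
  have hV0 : (G.P 0).V = 0 := by simpa using hG 0 ⟨S₀, hS₀⟩
  have hpay0 : ∀ S, (G.P 0).payoff S = 0 := fun S => hG _ S
  simp only [GeneralizedPortfolio.endowment, hV0, EReal.coe_zero, zero_add,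
    EReal.coe_ennreal_eq_coe_ennreal_iff] at hv
  subst hv
  by_cases hV : ∑' m, ENNReal.ofReal (G.P (m + 1)).V = ⊤
  · simp [hV]
  have hsum : Summable fun m => (G.P (m + 1)).V := by
    have := ENNReal.summable_toReal hV
    simpa only [ENNReal.toReal_ofReal (hQ _).1] using this
  rw [← ENNReal.ofReal_tsum_of_nonneg (fun m => (hQ m).1) hsum]
  obtain ⟨R, hRV, hR0, hR⟩ := P.exists_hedge_negPart hb hc hQ hsum fun S hS => by
    have h := hhedge S
    simp only [GeneralizedPortfolio.payoff, hpay0, EReal.coe_zero, zero_add,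
      EReal.coe_ennreal_le_coe_ennreal_iff] at h
    rw [← ENNReal.ofReal_tsum_of_nonneg (fun m => (hQ m).2 S) hS] at h
    have h0 : 0 ≤ ∑' m, (G.P (m + 1)).payoff S := tsum_nonneg fun m => (hQ m).2 S
    exact max_le ((ENNReal.ofReal_le_ofReal_iff h0).1 h) h0
  obtain ⟨N, hNV, hN0, hN⟩ := SimplePortfolio.exists_arbitrage 𝒮 P.n
  have hRV0 : 0 ≤ R.V := by
    obtain ⟨T, -, -, h⟩ := R.exists_payoff_le_wealth hb hc 0 ⟨S₀, hS₀⟩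
    exact (hR0 T).trans (by simpa using h)
  let Z : SimplePortfolio 𝒮 := ⟨0, 0, fun _ _ => 0, by simp⟩
  let K : GeneralizedPortfolio 𝒮 :=
    ⟨fun m => Nat.casesOn m Z fun m => Nat.casesOn m R fun _ => N, by
      rintro (_ | _ | m) h
      · omega
      · exact ⟨hRV0, hR0⟩
      · exact ⟨hNV.ge, hN0⟩⟩
  have hKpay : ∀ S, K.payoff S = ((ENNReal.ofReal (R.payoff S) +
      ∑' _ : ℕ, ENNReal.ofReal (N.payoff S) : ℝ≥0∞) : EReal) := by
    intro S
    rw [GeneralizedPortfolio.payoff, tsum_eq_zero_add' ENNReal.summable]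
    simp [K, Z, SimplePortfolio.payoff, SimplePortfolio.wealth]
  have hKend : K.endowment = ((ENNReal.ofReal R.V : ℝ≥0∞) : EReal) := by
    rw [GeneralizedPortfolio.endowment, tsum_eq_zero_add' ENNReal.summable]
    simp [K, Z, hNV]
  have hle : barI 𝒮 (fun S => ENNReal.ofReal (-P.payoff S)) ≤ ENNReal.ofReal R.V := by
    refine sInf_le ⟨K, ?_, ?_, hKend⟩
    · intro j S
      simp [K, Z, SimplePortfolio.wealth]
    · intro S
      rw [hKpay, EReal.coe_ennreal_le_coe_ennreal_iff]
      by_cases hS : ∀ i < P.n, GoodStep i S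
      · exact (ENNReal.ofReal_le_ofReal (hR S hS)).trans le_self_add
      · push Not at hS
        have : ENNReal.ofReal (N.payoff S) ≠ 0 := by simpa using hN S hS
        -- Infinitely many free copies of a strict profit pay infinity.
        rw [ENNReal.tsum_const_eq_top_of_ne_zero this]
        simp
  calc (P.V : EReal) + (barI 𝒮 (fun S => ENNReal.ofReal (-P.payoff S)) : EReal)
      ≤ (P.V : EReal) + ((ENNReal.ofReal R.V : ℝ≥0∞) : EReal) :=
        add_le_add le_rfl (EReal.coe_ennreal_le_coe_ennreal_iff.2 hle)
    _ = ((ENNReal.ofReal (∑' m, (G.P (m + 1)).V) : ℝ≥0∞) : EReal) := by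
        rw [EReal.coe_ennreal_ofReal, EReal.coe_ennreal_ofReal, max_eq_left hRV0,
          max_eq_left (tsum_nonneg fun m => (hQ m).1), hRV, ← EReal.coe_add]
        congr 1
        ring

theorem koenig_of_balanced (hne : 𝒮.Nonempty) (hb : Balanced 𝒮)
    (hc : IsCompleteTrajectorySet 𝒮) : Koenig 𝒮 := by
  refine ⟨lawOfOnePrice_of_balanced hne hb hc, fun P => ?_⟩
  -- The infimum lives in `ℝ≥0∞`, so the possibly negative left side is first truncated at zero.
  have h : ((P.V : EReal) +
      (barI 𝒮 (fun S => ENNReal.ofReal (-P.payoff S)) : EReal)).toENNReal ≤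
      barI 𝒮 (fun S => ENNReal.ofReal (P.payoff S)) := by
    refine le_sInf ?_
    rintro v ⟨G, hG, hhedge, hv⟩
    have := EReal.toENNReal_le_toENNReal (barI_negPart_le hne hb hc P hG hhedge hv)
    simpa using this
  rw [← EReal.coe_ennreal_le_coe_ennreal_iff, EReal.coe_toENNReal_eq_max] at h
  exact (le_max_right _ _).trans h

/-! ### Martingale measures on binary trees -/

theorem Balanced.exists_martingale_step (hb : Balanced 𝒮) (i : ℕ) (S : 𝒮) :
    ∃ (p : ℝ) (next : Bool → 𝒮), 0 ≤ p ∧ p ≤ 1 ∧ (∀ b, AgreeUpTo i S (next b)) ∧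
      p * (next true).1 (i + 1) + (1 - p) * (next false).1 (i + 1) = S.1 i := by
  rcases hb S i with ⟨⟨U, hU, hU'⟩, W, hW, hW'⟩ | ⟨T, hT, hT'⟩
  · have h : 0 < U.1 (i + 1) - W.1 (i + 1) := by linarith
    refine ⟨(S.1 i - W.1 (i + 1)) / (U.1 (i + 1) - W.1 (i + 1)), fun b => cond b U W,
      ?_, ?_, ?_, ?_⟩
    · exact div_nonneg (by linarith) h.le
    · rw [div_le_one h]
      linarith
    · rintro (_ | _)
      exacts [hW, hU]
    · simp only [cond_true, cond_false]
      field_simp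
      ring
  · exact ⟨0, fun _ => T, le_rfl, zero_le_one, fun _ => hT, by simpa using hT'⟩

/-- The walk through a trajectory set which is directed by a sequence of binary decisions. -/
def walk (next : ℕ → 𝒮 → Bool → 𝒮) (S₀ : 𝒮) (ω : ℕ → Bool) : ℕ → 𝒮
  | 0 => S₀
  -- Coordinate `0` carries no decision; the trajectory measure fixes it as its starting point.
  | n + 1 => next n (walk next S₀ ω n) (ω (n + 1))

theorem walk_congr (next : ℕ → 𝒮 → Bool → 𝒮) (S₀ : 𝒮) {n : ℕ} {ω ω' : ℕ → Bool}
    (h : ∀ i ≤ n, ω i = ω' i) : walk next S₀ ω n = walk next S₀ ω' n := by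
  induction n with
  | zero => rfl
  | succ n ih => rw [walk, walk, ih fun i hi => h i (by omega), h _ le_rfl]

/-- Extension of a finite sequence of binary decisions. -/
def extendFalse (n : ℕ) (x : Finset.Iic n → Bool) (i : ℕ) : Bool :=
  if h : i ∈ Finset.Iic n then x ⟨i, h⟩ else false

theorem walk_extendFalse (next : ℕ → 𝒮 → Bool → 𝒮) (S₀ : 𝒮) (n : ℕ) (ω : ℕ → Bool) :
    walk next S₀ (extendFalse n (Preorder.frestrictLe n ω)) n = walk next S₀ ω n :=
  walk_congr next S₀ fun i hi => by simp [extendFalse, hi]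

/-- The kernel which decides for `true` with a probability depending on the previous decisions. -/
def coinKernel (p : ∀ n : ℕ, (Finset.Iic n → Bool) → ℝ) (n : ℕ) :
    Kernel (Finset.Iic n → Bool) Bool :=
  ⟨fun x => ENNReal.ofReal (p n x) • Measure.dirac true +
    ENNReal.ofReal (1 - p n x) • Measure.dirac false, .of_discrete⟩

theorem isMarkovKernel_coinKernel {p : ∀ n : ℕ, (Finset.Iic n → Bool) → ℝ}
    (h0 : ∀ n x, 0 ≤ p n x) (h1 : ∀ n x, p n x ≤ 1) (n : ℕ) :
    IsMarkovKernel (coinKernel p n) := by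
  refine ⟨fun x => ⟨?_⟩⟩
  have := h1 n x
  simp [coinKernel, ← ENNReal.ofReal_add (h0 n x) (by linarith : 0 ≤ 1 - p n x)]

theorem integral_coinKernel {p : ∀ n : ℕ, (Finset.Iic n → Bool) → ℝ}
    (h0 : ∀ n x, 0 ≤ p n x) (h1 : ∀ n x, p n x ≤ 1) (n : ℕ) (x : Finset.Iic n → Bool)
    (f : Bool → ℝ) :
    ∫ b, f b ∂(coinKernel p n x) = p n x * f true + (1 - p n x) * f false := by
  have := h1 n x
  change ∫ b, f b ∂(ENNReal.ofReal (p n x) • Measure.dirac true +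
    ENNReal.ofReal (1 - p n x) • Measure.dirac false) = _
  rw [integral_add_measure (.smul_measure .of_finite (by simp)) (.smul_measure .of_finite (by simp)),
    integral_smul_measure, integral_smul_measure, integral_dirac, integral_dirac,
    ENNReal.toReal_ofReal (h0 n x), ENNReal.toReal_ofReal (by linarith), smul_eq_mul, smul_eq_mul]

/-- A function of finitely many binary decisions. -/
theorem measurable_comp_frestrictLe {α : Type*} [MeasurableSpace α] (n : ℕ)
    (f : (Finset.Iic n → Bool) → α) :
    Measurable fun ω : ℕ → Bool => f (Preorder.frestrictLe n ω) :=
  (Measurable.of_discrete (f := f)).comp (Preorder.measurable_frestrictLe n)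

theorem integrable_comp_frestrictLe (n : ℕ) (f : (Finset.Iic n → Bool) → ℝ)
    (μ : Measure (ℕ → Bool)) [IsFiniteMeasure μ] :
    Integrable (fun ω => f (Preorder.frestrictLe n ω)) μ :=
  (Integrable.of_finite (f := f) (μ := μ.map (Preorder.frestrictLe n))).comp_measurable
    (Preorder.measurable_frestrictLe n)

/-- Disintegration of the law of the first decisions and the next one: averaging over the next coin
given the past. This is the martingale property in tree coordinates. -/
theorem setIntegral_traj_coinKernel {p : ∀ n : ℕ, (Finset.Iic n → Bool) → ℝ}
    (h0 : ∀ n x, 0 ≤ p n x) (h1 : ∀ n x, p n x ≤ 1) [∀ n, IsMarkovKernel (coinKernel p n)]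
    (x₀ : Finset.Iic 0 → Bool) (n : ℕ)
    (A : Set (Finset.Iic n → Bool)) (f : (Finset.Iic n → Bool) → Bool → ℝ) :
    ∫ ω in Preorder.frestrictLe n ⁻¹' A, f (Preorder.frestrictLe n ω) (ω (n + 1))
        ∂(Kernel.traj (X := fun _ => Bool) (coinKernel p) 0 x₀) =
      ∫ ω in Preorder.frestrictLe n ⁻¹' A,
        (p n (Preorder.frestrictLe n ω) * f (Preorder.frestrictLe n ω) true +
          (1 - p n (Preorder.frestrictLe n ω)) * f (Preorder.frestrictLe n ω) false)
        ∂(Kernel.traj (X := fun _ => Bool) (coinKernel p) 0 x₀) := by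
  set μ := Kernel.traj (X := fun _ => Bool) (coinKernel p) 0 x₀
  have hmeas : Measurable fun ω : ℕ → Bool =>
      (Preorder.frestrictLe (π := fun _ => Bool) n ω, ω (n + 1)) :=
    (Preorder.measurable_frestrictLe n).prodMk (measurable_pi_apply _)
  have hmap := Kernel.partialTraj_compProd_eq_map_traj (X := fun _ => Bool) (κ := coinKernel p)
    (Nat.zero_le n) (x₀ := x₀)
  have hpart := Kernel.traj_map_frestrictLe_apply (X := fun _ => Bool) (κ := coinKernel p) 0 n x₀
  have hA : MeasurableSet A := .of_discrete
  calc ∫ ω in Preorder.frestrictLe n ⁻¹' A, f (Preorder.frestrictLe n ω) (ω (n + 1)) ∂μ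
      = ∫ z in A ×ˢ univ, f z.1 z.2
          ∂(μ.map fun ω => (Preorder.frestrictLe (π := fun _ => Bool) n ω, ω (n + 1))) := by
        rw [setIntegral_map (.of_discrete) (Measurable.of_discrete).aestronglyMeasurable
          hmeas.aemeasurable]
        congr 2
        ext ω
        simp
    _ = ∫ x in A, ∫ b, f x b ∂(coinKernel p n x)
          ∂(Kernel.partialTraj (X := fun _ => Bool) (coinKernel p) 0 n x₀) := by
        rw [← hmap, Measure.setIntegral_compProd hA .univ Integrable.of_finite.integrableOn]
        simp only [Measure.restrict_univ]
    _ = _ := by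
        rw [← hpart, setIntegral_map hA (Measurable.of_discrete).aestronglyMeasurable
          (Preorder.measurable_frestrictLe n).aemeasurable]
        simp only [integral_coinKernel h0 h1]
        rfl

theorem finiteSupportMartingaleMeasures_nonempty (hne : 𝒮.Nonempty) (hb : Balanced 𝒮)
    (hc : IsCompleteTrajectorySet 𝒮) : (finiteSupportMartingaleMeasures 𝒮).Nonempty := by
  obtain ⟨S₀, hS₀⟩ := hne
  choose p next hp0 hp1 hnext hmart using hb.exists_martingale_step
  let W : (ℕ → Bool) → ℕ → 𝒮 := walk next ⟨S₀, hS₀⟩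
  have hW : ∀ ω n, W ω (n + 1) = next n (W ω n) (ω (n + 1)) := fun _ _ => rfl
  choose L hL using fun ω => hc.exists_limit (W ω) fun n => by rw [hW]; exact hnext _ _ _
  let E : ∀ n : ℕ, (Finset.Iic n → Bool) → 𝒮 := fun n x => W (extendFalse n x) n
  have hE : ∀ n ω, E n (Preorder.frestrictLe n ω) = W ω n := walk_extendFalse next _
  let q : ∀ n : ℕ, (Finset.Iic n → Bool) → ℝ := fun n x => p n (E n x)
  have hq0 : ∀ n x, 0 ≤ q n x := fun _ _ => hp0 _ _
  have hq1 : ∀ n x, q n x ≤ 1 := fun _ _ => hp1 _ _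
  have := isMarkovKernel_coinKernel hq0 hq1
  let μ := Kernel.traj (X := fun _ => Bool) (coinKernel q) 0 fun _ => false
  have hLE : ∀ n, ∀ i ≤ n, ∀ ω, (L ω).1 i = (E n (Preorder.frestrictLe n ω)).1 i := by
    intro n i hi ω
    rw [hE, hL ω n i hi]
  have hLm : Measurable L := by
    refine Measurable.subtype_mk (f := fun ω => (L ω).1) (measurable_pi_lambda _ fun n => ?_)
    simp only [hLE n n le_rfl]
    exact measurable_comp_frestrictLe n fun x => (E n x).1 n
  have hint : ∀ n, Integrable (coord 𝒮 n) (μ.map L) := by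
    intro n
    rw [integrable_map_measure (stronglyMeasurable_coord 𝒮 n).aestronglyMeasurable hLm.aemeasurable]
    simp only [Function.comp_def, coord, hLE n n le_rfl]
    exact integrable_comp_frestrictLe n (fun x => (E n x).1 n) μ
  have : IsProbabilityMeasure (μ.map L) := Measure.isProbabilityMeasure_map hLm.aemeasurable
  refine ⟨μ.map L, ⟨inferInstance, ?_⟩, ?_⟩
  · refine martingale_of_setIntegral_eq_succ (Filtration.stronglyAdapted_natural _) hint ?_
    intro n s hs
    -- Prices up to time `n` depend only on the decisions up to `n`, and every set of such finite
    -- decision sequences is measurable.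
    obtain ⟨A, hA⟩ : ∃ A : Set (Finset.Iic n → Bool),
        L ⁻¹' s = Preorder.frestrictLe (π := fun _ => Bool) n ⁻¹' A := by
      rw [Filtration.natural_eq_comap] at hs
      obtain ⟨B, -, rfl⟩ := hs
      refine ⟨{x | (fun j : Set.Iic n => (E n x).1 j) ∈ B}, ?_⟩
      ext ω
      have : (fun j : Set.Iic n => coord 𝒮 j (L ω)) =
          fun j : Set.Iic n => (E n (Preorder.frestrictLe n ω)).1 j :=
        funext fun j => hLE n j j.2 ω
      simp only [mem_preimage, mem_ofPred_eq, this]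
    have hs' := (Filtration.natural (coord 𝒮) (stronglyMeasurable_coord 𝒮)).le n s hs
    rw [setIntegral_map hs' (stronglyMeasurable_coord 𝒮 n).aestronglyMeasurable hLm.aemeasurable,
      setIntegral_map hs' (stronglyMeasurable_coord 𝒮 _).aestronglyMeasurable hLm.aemeasurable, hA]
    have h1 : ∀ ω, coord 𝒮 (n + 1) (L ω) =
        (next n (E n (Preorder.frestrictLe n ω)) (ω (n + 1))).1 (n + 1) := fun ω => by
      rw [hE, ← hW, coord, hL ω (n + 1) _ le_rfl]
    have h2 : ∀ ω, coord 𝒮 n (L ω) = (E n (Preorder.frestrictLe n ω)).1 n := hLE n n le_rfl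
    simp only [h1, h2]
    rw [setIntegral_traj_coinKernel hq0 hq1 _ n A fun x b => (next n (E n x) b).1 (n + 1)]
    simp only [q, hmart]
    rfl
  · have hfin : ∀ n, (range fun x : Finset.Iic n → Bool => fun i : Finset.Iic n =>
        (E n x).1 i).Finite := fun n => finite_range _
    -- Requiring every prefix to occur in the tree gives a countable intersection of preimages of
    -- finite sets, hence a measurable set.
    let A : Set 𝒮 := {S | ∀ n : ℕ, (fun i : Finset.Iic n => S.1 i) ∈
      range fun x : Finset.Iic n → Bool => fun i : Finset.Iic n => (E n x).1 i}
    have hAm : MeasurableSet A := by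
      simp only [A, ofPred_forall]
      refine MeasurableSet.iInter fun n => ?_
      exact (measurable_pi_lambda _ fun i => (measurable_pi_apply _).comp measurable_subtype_coe)
        (hfin n).measurableSet
    refine ⟨A, hAm, ?_, fun n => ?_⟩
    · rw [Measure.map_apply hLm hAm]
      have : L ⁻¹' A = univ := by
        refine eq_univ_of_forall fun ω n => ⟨Preorder.frestrictLe n ω, ?_⟩
        funext i
        exact (hLE n i (Finset.mem_Iic.1 i.2) ω).symm
      rw [this, measure_univ]
    · refine (finite_range fun x => node 𝒮 (E n x).1 n).subset ?_
      rintro _ ⟨S, hS, rfl⟩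
      obtain ⟨x, hx⟩ := hS n
      refine ⟨x, ?_⟩
      ext T
      have : ∀ i ≤ n, (E n x).1 i = S.1 i := fun i hi => congrFun hx ⟨i, Finset.mem_Iic.2 hi⟩
      simp only [node, mem_ofPred_eq]
      exact and_congr_right fun _ => forall₂_congr fun i hi => by rw [this i hi]

end ModelFree

end

theorem theorem6p2 (s₀ : ℝ) (𝒮 : Set (ℕ → ℝ)) (hne : 𝒮.Nonempty)
    (hs₀ : ∀ S ∈ 𝒮, S 0 = s₀)
    (hcomplete : ModelFree.IsCompleteTrajectorySet 𝒮)
    (hII : ∀ S ∈ 𝒮, ∀ j : ℕ, ¬ ModelFree.IsArbitrageNodeTypeII 𝒮 S j) :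
    (ModelFree.finiteSupportMartingaleMeasures 𝒮).Nonempty ∧
      ModelFree.AtEveryNode ModelFree.Leinert 𝒮 ∧
      ModelFree.AtEveryNode ModelFree.Koenig 𝒮 := by
  have hb := ModelFree.balanced_of_not_typeII hII
  have hne' : ∀ S ∈ 𝒮, ∀ j, (ModelFree.shiftedSpace 𝒮 S j).Nonempty :=
    fun S hS j => ⟨_, S, ⟨hS, fun _ _ => rfl⟩, rfl⟩
  exact ⟨ModelFree.finiteSupportMartingaleMeasures_nonempty hne hb hcomplete,
    fun S hS j => ModelFree.leinert_of_balanced (hne' S hS j) (hb.shiftedSpace S j)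
      (hcomplete.shiftedSpace S j),
    fun S hS j => ModelFree.koenig_of_balanced (hne' S hS j) (hb.shiftedSpace S j)
      (hcomplete.shiftedSpace S j)⟩
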